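/- Let $n\ge2$, $\lambda=\frac{n-1}{2}$, and let $\mathcal S^n\subset\mathbb R^{n+1}$ be the unit sphere with spherical coordinates $\theta_1,\dots,\theta_{n-1}\in[0,\pi]$, $\varphi\in[0,2\pi)$ given by $$x_\tau=\sin\theta_1\cdots\sin\theta_{\tau-1}\cos\theta_\tau\ (1\le\tau\le n-1),\qquad x_n=\sin\theta_1\cdots\sin\theta_{n-1}\cos\varphi,\qquad x_{n+1}=\sin\theta_1\cdots\sin\theta_{n-1}\sin\varphi.$$ Let $C_m^{\mu}$ be the Gegenbauer polynomials, $$C_m^\mu(t)=\sum_{j=0}^{\lfloor m/2\rfloor}(-1)^j\frac{\Gamma(\mu+m-j)}{j!\,(m-2j)!\,\Gamma(\mu)}(2t)^{m-2j}.$$ For an integer $l\ge0$ and integers $k=(\kappa_1,\dots,\kappa_{n-1})$ put $k_0=l$ and $k_\tau=|\kappa_\tau|$ for $1\le\tau\le n-1$. If $l=k_0\ge k_1\ge\dots\ge k_{n-1}$ and $\kappa_\tau\ge0$ for $\tau<n-1$, define the hyperspherical harmonic $$Y_l^k(x)=A_l^k\prod_{\tau=1}^{n-1}C_{k_{\tau-1}-k_\tau}^{\frac{n-\tau}2+k_\tau}(\cos\theta_\tau)\sin^{k_\tau}\theta_\tau\cdot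 e^{i\kappa_{n-1}\varphi},$$ $$A_l^k=\left(\frac1{\Gamma(\frac{n+1}2)}\prod_{\tau=1}^{n-1}\frac{2^{n-\tau+2k_\tau-2}(k_{\tau-1}-k_\tau)!\,(n-\tau+2k_{\tau-1})\,\Gamma^2(\frac{n-\tau}2+k_\tau)}{\sqrt\pi\,(n-\tau+k_{\tau-1}+k_\tau-1)!}\right)^{1/2},$$ and put $Y_l^k=0$ for all other $k$. Let $\Upsilon_\Theta$ be the rotation $$\Upsilon_\Theta x=(x_1\cos\Theta-x_2\sin\Theta,\ x_1\sin\Theta+x_2\cos\Theta,\ x_3,\dots,x_{n+1}).$$ Set $\beta_{l,-1}=0$ and, for $0\le k\le l$, $$\beta_{l,k}=\sqrt{\frac{(k+1)(2\lambda+k-1)(l-k)(2\lambda+l+k)}{(2\lambda+2k-1)(2\lambda+2k+1)}};$$ for $n=2$ (that is, $\lambda=\frac12$) this is read in its simplified form $\beta_{l,k}=\frac12\sqrt{(l-k)(l+k+1)}$, also at $k=0$. (i) Let $n\ge3$ and $l\ge0$. For every integer $0\le k_1\le l$ and every $x\in\mathcal S^n$ the function $\Theta\mapsto Y_l^{(k_1,0,\dots,0)}(\Upsilon_\Theta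 x)$ is differentiable at $\Theta=0$ and $$\left.\frac{\partial}{\partial\Theta}Y_l^{(k_1,0,\dots,0)}(\Upsilon_\Theta x)\right|_{\Theta=0}=\beta_{l,k_1-1}\,Y_l^{(k_1-1,0,\dots,0)}(x)-\beta_{l,k_1}\,Y_l^{(k_1+1,0,\dots,0)}(x).$$ (ii) Let $n=2$ and $l\ge0$. Define $\widetilde Y_l^k=Y_l^{-k}+Y_l^{k}$ for $k=0,1,\dots,l$ (so $\widetilde Y_l^0=2Y_l^0$) and $\widetilde Y_l^k=0$ for all other integers $k$. For every $x\in\mathcal S^2$ the following derivatives exist and satisfy $$\left.\frac{\partial}{\partial\Theta}\widetilde Y_l^0(\Upsilon_\Theta x)\right|_{\Theta=0}=-\sqrt{l(l+1)}\,\widetilde Y_l^1(x),$$ $$\left.\frac{\partial}{\partial\Theta}\widetilde Y_l^k(\Upsilon_\Theta x)\right|_{\Theta=0}=\beta_{l,k-1}\,\widetilde Y_l^{k-1}(x)-\beta_{l,k}\,\widetilde Y_l^{k+1}(x)\qquad(k=1,\dots,l).$$ -/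

import Mathlib

noncomputable section

namespace Hyperspherical

/-- The Gegenbauer polynomial `C_l^lam(t)`, for `lam` not a nonpositive integer. -/
def gegenbauer (lam : ℝ) (l : ℕ) (t : ℝ) : ℝ :=
  ∑ j ∈ Finset.range (l / 2 + 1),
    (-1 : ℝ) ^ j * Real.Gamma (lam + l - j) /
      ((j.factorial : ℝ) * ((l - 2 * j).factorial : ℝ) * Real.Gamma lam) * (2 * t) ^ (l - 2 * j)

/-- The coordinate `x_j` of `x ∈ ℝ^(n+1)`, numbered `1, …, n + 1` (and `0` for other `j`). -/
def coord (n : ℕ) (x : EuclideanSpace ℝ (Fin (n + 1))) (j : ℕ) : ℝ :=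
  if h : 1 ≤ j ∧ j ≤ n + 1 then x ⟨j - 1, by omega⟩ else 0

/-- `√(x_τ² + … + x_(n+1)²)`. -/
def tailNorm (n : ℕ) (x : EuclideanSpace ℝ (Fin (n + 1))) (τ : ℕ) : ℝ :=
  √(∑ j ∈ Finset.Icc τ (n + 1), coord n x j ^ 2)

/-- The spherical coordinate `θ_τ ∈ [0, π]`, `1 ≤ τ ≤ n - 1`, of a unit vector `x`; where the
coordinate is not unique (`x_τ = … = x_(n+1) = 0`) this picks the value `π / 2`. -/
def polarAngle (n : ℕ) (x : EuclideanSpace ℝ (Fin (n + 1))) (τ : ℕ) : ℝ :=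
  Real.arccos (coord n x τ / tailNorm n x τ)

/-- The spherical coordinate `φ` of `x`, determined modulo `2π`: the angle of `(x_n, x_(n+1))`.
Only `exp (i m φ)` with integer `m` is used below. -/
def azimuth (n : ℕ) (x : EuclideanSpace ℝ (Fin (n + 1))) : ℝ :=
  Complex.arg ⟨coord n x n, coord n x (n + 1)⟩

/-- A multi-index `(k_1, …, k_(n-1))` is given as a function `k : ℕ → ℤ` of which only the values
at `1, …, n - 1` matter. This is the sequence `k_0 = l`, `k_1`, …, `|k_(n-1)|`. -/
def absIndex (l : ℕ) (k : ℕ → ℤ) (τ : ℕ) : ℕ :=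
  if τ = 0 then l else (k τ).natAbs

/-- `l = k_0 ≥ k_1 ≥ … ≥ k_(n-2) ≥ |k_(n-1)| ≥ 0`. -/
def IsIndex (n l : ℕ) (k : ℕ → ℤ) : Prop :=
  (∀ τ, 1 ≤ τ → τ ≤ n - 1 → absIndex l k τ ≤ absIndex l k (τ - 1)) ∧
    ∀ τ, 1 ≤ τ → τ < n - 1 → 0 ≤ k τ

/-- The normalization constant `A_l^k`. -/
def normConst (n l : ℕ) (k : ℕ → ℤ) : ℝ :=
  √(1 / Real.Gamma (((n : ℝ) + 1) / 2) *
    ∏ τ ∈ Finset.Icc 1 (n - 1),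
      ((2 : ℝ) ^ ((n : ℤ) - τ + 2 * absIndex l k τ - 2) *
          ((absIndex l k (τ - 1) - absIndex l k τ).factorial : ℝ) *
          ((n : ℝ) - τ + 2 * absIndex l k (τ - 1)) *
          Real.Gamma (((n : ℝ) - τ) / 2 + absIndex l k τ) ^ 2 /
        (√Real.pi * ((n - τ + absIndex l k (τ - 1) + absIndex l k τ - 1).factorial : ℝ))))

/-- The expression of `Y_l^k` in spherical coordinates `(θ_1, …, θ_(n-1), φ)`. -/
def harmonicAngles (n l : ℕ) (k : ℕ → ℤ) (θ : ℕ → ℝ) (φ : ℝ) : ℂ :=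
  ((normConst n l k *
      ∏ τ ∈ Finset.Icc 1 (n - 1),
        gegenbauer (((n : ℝ) - τ) / 2 + absIndex l k τ)
            (absIndex l k (τ - 1) - absIndex l k τ) (Real.cos (θ τ)) *
          Real.sin (θ τ) ^ absIndex l k τ : ℝ) : ℂ) *
    Complex.exp (Complex.I * (k (n - 1) : ℂ) * (φ : ℂ))

open Classical in
/-- The hyperspherical harmonic `Y_l^k` on the unit sphere of `ℝ^(n+1)` (used at unit vectors
only), with the convention `Y_l^k = 0` when `k` is not an admissible multi-index. -/
def harmonic (n l : ℕ) (k : ℕ → ℤ) (x : EuclideanSpace ℝ (Fin (n + 1))) : ℂ :=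
  if IsIndex n l k then harmonicAngles n l k (polarAngle n x) (azimuth n x) else 0

/-- The multi-index `(k₁, 0, …, 0)`; for `n = 2` this is just `k₁`. -/
def firstIndex (k₁ : ℤ) : ℕ → ℤ := fun τ => if τ = 1 then k₁ else 0

/-- `Ỹ_l^k = Y_l^(-k) + Y_l^k` on the two-dimensional sphere for `k = 0, …, l`, otherwise `0`. -/
def symHarmonic (l : ℕ) (k : ℤ) (x : EuclideanSpace ℝ (Fin (2 + 1))) : ℂ :=
  if 0 ≤ k ∧ k ≤ l then harmonic 2 l (firstIndex (-k)) x + harmonic 2 l (firstIndex k) x else 0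

/-- The matrix of the rotation by the angle `Θ` in the plane of the first two coordinates. -/
def rotationMatrix (n : ℕ) (Θ : ℝ) : Matrix (Fin (n + 1)) (Fin (n + 1)) ℝ :=
  Matrix.of fun i j =>
    if i.val = 0 ∧ j.val = 0 then Real.cos Θ
    else if i.val = 0 ∧ j.val = 1 then -Real.sin Θ
    else if i.val = 1 ∧ j.val = 0 then Real.sin Θ
    else if i.val = 1 ∧ j.val = 1 then Real.cos Θ
    else if i = j then 1 else 0

/-- The rotation `Υ_Θ` of `ℝ^(n+1)`. -/
def rotate (n : ℕ) (Θ : ℝ) (x : EuclideanSpace ℝ (Fin (n + 1))) :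
    EuclideanSpace ℝ (Fin (n + 1)) :=
  Matrix.toEuclideanLin (rotationMatrix n Θ) x

/-- The expression under the root in `β_(l,k)`, `lam` being `(n - 1) / 2`. -/
def betaRadicand (lam : ℝ) (l : ℕ) (k : ℤ) : ℝ :=
  ((k + 1) * (2 * lam + k - 1) * (l - k) * (2 * lam + l + k)) /
    ((2 * lam + 2 * k - 1) * (2 * lam + 2 * k + 1))

/-- The coefficient `β_(l,k)` on the sphere of dimension `n`, with `β_(l,k) = 0` for `k < 0`. For
`n = 2` the general expression is simplified, which gives a meaning to it for `k = 0`, where it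
reads `0 / 0`. -/
def beta (n l : ℕ) (k : ℤ) : ℝ :=
  if k < 0 then 0
  else if n = 2 then √(((l : ℝ) - k) * (l + k + 1)) / 2
  else √(betaRadicand (((n : ℝ) - 1) / 2) l k)

/-- For `n = 2` and `k ≥ 1` the simplified expression agrees with the general one. -/
theorem beta_two (l : ℕ) (k : ℤ) (hk : 1 ≤ k) :
    beta 2 l k = √(betaRadicand (1 / 2) l k) := by
  have hk' : (1 : ℝ) ≤ k := by exact_mod_cast hk
  have h0 : ¬ k < 0 := by omega
  have h : betaRadicand (1 / 2) l k = ((l : ℝ) - k) * (l + k + 1) / 2 ^ 2 := by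
    unfold betaRadicand
    rw [div_eq_div_iff (by nlinarith) (by norm_num)]
    ring
  rw [h, Real.sqrt_div' _ (by norm_num), Real.sqrt_sq (by norm_num)]
  simp [beta, h0]

theorem tailNorm_sq (n : ℕ) (x : EuclideanSpace ℝ (Fin (n + 1))) {τ : ℕ} (h : τ ≤ n + 1) :
    tailNorm n x τ ^ 2 = coord n x τ ^ 2 + tailNorm n x (τ + 1) ^ 2 := by
  unfold tailNorm
  rw [Real.sq_sqrt (Finset.sum_nonneg fun _ _ => sq_nonneg _),
    Real.sq_sqrt (Finset.sum_nonneg fun _ _ => sq_nonneg _),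
    ← Finset.add_sum_Ioc_eq_sum_Icc h]
  congr 2
  ext j
  simp only [Finset.mem_Ioc, Finset.mem_Icc]
  omega

theorem tailNorm_mul_cos (n : ℕ) (x : EuclideanSpace ℝ (Fin (n + 1))) {τ : ℕ} (h : τ ≤ n + 1) :
    tailNorm n x τ * Real.cos (polarAngle n x τ) = coord n x τ := by
  have h1 := tailNorm_sq n x h
  have h2 : 0 ≤ tailNorm n x τ := Real.sqrt_nonneg _
  rcases h2.eq_or_lt with h0 | h0
  · rw [← h0] at h1 ⊢
    nlinarith [sq_nonneg (coord n x τ), sq_nonneg (tailNorm n x (τ + 1))]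
  · have h3 : |coord n x τ / tailNorm n x τ| ≤ 1 := by
      rw [abs_div, abs_of_pos h0, div_le_one h0]
      exact abs_le_of_sq_le_sq (by nlinarith [sq_nonneg (tailNorm n x (τ + 1))]) h0.le
    rw [polarAngle, Real.cos_arccos (abs_le.1 h3).1 (abs_le.1 h3).2]
    field_simp

theorem tailNorm_mul_sin (n : ℕ) (x : EuclideanSpace ℝ (Fin (n + 1))) {τ : ℕ} (h : τ ≤ n + 1) :
    tailNorm n x τ * Real.sin (polarAngle n x τ) = tailNorm n x (τ + 1) := by
  have h1 := tailNorm_sq n x h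
  have h2 : 0 ≤ tailNorm n x τ := Real.sqrt_nonneg _
  have h3 := tailNorm_mul_cos n x h
  have h4 : 0 ≤ Real.sin (polarAngle n x τ) :=
    Real.sin_nonneg_of_nonneg_of_le_pi (Real.arccos_nonneg _) (Real.arccos_le_pi _)
  have h5 : 0 ≤ tailNorm n x (τ + 1) := Real.sqrt_nonneg _
  have h6 := Real.sin_sq_add_cos_sq (polarAngle n x τ)
  refine (sq_eq_sq₀ (mul_nonneg h2 h4) h5).1 ?_
  rw [← h3] at h1
  linear_combination h1 + tailNorm n x τ ^ 2 * h6

theorem tailNorm_one (n : ℕ) (x : EuclideanSpace ℝ (Fin (n + 1))) : tailNorm n x 1 = ‖x‖ := by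
  rw [tailNorm, EuclideanSpace.norm_eq, Finset.sum_fin_eq_sum_range]
  congr 1
  rw [Finset.range_eq_Ico, Finset.sum_Ico_eq_sum_range, ← Finset.Ico_add_one_right_eq_Icc,
    Finset.sum_Ico_eq_sum_range]
  refine Finset.sum_congr (by simp) fun i hi => ?_
  have hi' : i < n + 1 := by simpa using hi
  have h1 : 1 ≤ 1 + i ∧ 1 + i ≤ n + 1 := by omega
  simp [coord, h1, hi']

theorem prod_sin (n : ℕ) (x : EuclideanSpace ℝ (Fin (n + 1))) (hx : ‖x‖ = 1) {τ : ℕ}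
    (h : τ ≤ n + 1) :
    ∏ j ∈ Finset.Icc 1 τ, Real.sin (polarAngle n x j) = tailNorm n x (τ + 1) := by
  induction τ with
  | zero => simp [tailNorm_one, hx]
  | succ m ih =>
    rw [Finset.prod_Icc_succ_top (by omega), ih (by omega), tailNorm_mul_sin n x h]

/-- The angles are spherical coordinates of `x`: the first `n - 1` coordinates. -/
theorem coord_eq (n : ℕ) (x : EuclideanSpace ℝ (Fin (n + 1))) (hx : ‖x‖ = 1) {τ : ℕ}
    (h1 : 1 ≤ τ) (h2 : τ ≤ n - 1) :
    coord n x τ = (∏ j ∈ Finset.Icc 1 (τ - 1), Real.sin (polarAngle n x j)) *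
      Real.cos (polarAngle n x τ) := by
  rw [prod_sin n x hx (by omega), Nat.sub_add_cancel h1, tailNorm_mul_cos n x (by omega)]

/-- The angles are spherical coordinates of `x`: the last two coordinates. -/
theorem coord_last_eq (n : ℕ) (hn : 1 ≤ n) (x : EuclideanSpace ℝ (Fin (n + 1))) (hx : ‖x‖ = 1) :
    coord n x n = (∏ j ∈ Finset.Icc 1 (n - 1), Real.sin (polarAngle n x j)) *
        Real.cos (azimuth n x) ∧
      coord n x (n + 1) = (∏ j ∈ Finset.Icc 1 (n - 1), Real.sin (polarAngle n x j)) *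
        Real.sin (azimuth n x) := by
  have h : tailNorm n x n = ‖(⟨coord n x n, coord n x (n + 1)⟩ : ℂ)‖ := by
    rw [tailNorm, Complex.norm_def, Complex.normSq_mk, Finset.sum_Icc_succ_top (by omega)]
    simp [sq]
  rw [prod_sin n x hx (by omega), Nat.sub_add_cancel hn, h]
  have h1 := Complex.norm_mul_cos_arg ⟨coord n x n, coord n x (n + 1)⟩
  have h2 := Complex.norm_mul_sin_arg ⟨coord n x n, coord n x (n + 1)⟩
  exact ⟨h1.symm, h2.symm⟩

end Hyperspherical

end

/-! On the unit sphere put t = x_1 = cos θ_1 and u = x_2. For n ≥ 3 the factor sin^k θ_1 can be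
absorbed into C_k^{(n-2)/2}(cos θ_2), so up to its constant Y_l^(k,0,…,0) is the polynomial P_k =
C_{l-k}^ν(t) q_k(u, 1 - t²), with ν = (n-1)/2 + k and q_k a homogenized Gegenbauer polynomial
(`harmonic_firstIndex`). The singularities of the angles thus disappear, and the rotation enters
only through t' = -u, u' = t.

The product rule gives -u (C_{l-k}^ν)' q_k + C_{l-k}^ν q_k'. Here q_k' is a multiple of t q_{k-1},
and the three-term recurrence splits u q_k into q_{k+1} and (1 - t²) q_{k-1}. The q_{k+1} part
already carries (C_{l-k}^ν)' = 2ν C_{l-k-1}^{ν+1}, so it is a multiple of P_{k+1}. The q_{k-1} parts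
combine by `gegenbauer_ladder` into C_{l-k+1}^{ν-1}, which gives P_{k-1}. This is
`hasDerivAt_homGegenbauer_mul`. The quotient of consecutive normalization constants then turns both
coefficients into β (`beta_mul_normConst_succ`, `beta_mul_normConst`).

For n = 2 the parameter (n-2)/2 is 0 and q_k degenerates; 2 Re (x_2 + i x_3)^k takes its place and
obeys relations of the same shape. -/

noncomputable section

namespace Hyperspherical

/-! ### Homogenized Gegenbauer polynomials and their coefficients -/

/-- Coefficient of `(2 * u) ^ (k - 2 * j) * s ^ j` in the homogenized Gegenbauer polynomial. -/
def gegenbauerCoeff (μ : ℝ) (k : ℤ) (j : ℕ) : ℝ :=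
  if 2 * (j : ℤ) ≤ k then
    (-1 : ℝ) ^ j * Real.Gamma (μ + k - j) /
      ((j.factorial : ℝ) * ((k - 2 * j).toNat.factorial : ℝ) * Real.Gamma μ)
  else 0

/-- The homogenized Gegenbauer polynomial, the coefficient of `z ^ k` in
`(1 - 2 u z + s z²) ^ (-μ)`; it vanishes for `k < 0`. -/
def homGegenbauer (μ : ℝ) (k : ℤ) (u s : ℝ) : ℝ :=
  ∑ j ∈ Finset.range (k.toNat + 1), gegenbauerCoeff μ k j * (2 * u) ^ (k - 2 * j).toNat * s ^ j

theorem gegenbauerCoeff_of_lt {μ : ℝ} {k : ℤ} {j : ℕ} (h : k < 2 * j) :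
    gegenbauerCoeff μ k j = 0 := if_neg (not_le.2 h)

/-- Writing k = a + 2j removes the truncated subtraction; the coefficient identities below are
checked in this form. -/
theorem gegenbauerCoeff_add (μ : ℝ) (a j : ℕ) :
    gegenbauerCoeff μ (a + 2 * j) j =
      (-1 : ℝ) ^ j * Real.Gamma (μ + a + j) / ((j.factorial : ℝ) * a.factorial * Real.Gamma μ) := by
  have h : 2 * (j : ℤ) ≤ a + 2 * j := by omega
  rw [gegenbauerCoeff, if_pos h, show ((a : ℤ) + 2 * j - 2 * j).toNat = a by omega]
  push_cast
  rw [show μ + (a + 2 * j) - j = μ + a + j by ring]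

/-- Terms with 2j > k vanish, so sums of different degrees can be compared over one common range. -/
theorem homGegenbauer_eq_sum (μ : ℝ) {k : ℤ} (u s : ℝ) {N : ℕ} (hN : k < 2 * N) :
    homGegenbauer μ k u s =
      ∑ j ∈ Finset.range N, gegenbauerCoeff μ k j * (2 * u) ^ (k - 2 * j).toNat * s ^ j := by
  have key : ∀ M : ℕ, k < 2 * M → ∀ K, M ≤ K →
      ∑ j ∈ Finset.range M, gegenbauerCoeff μ k j * (2 * u) ^ (k - 2 * j).toNat * s ^ j =
      ∑ j ∈ Finset.range K, gegenbauerCoeff μ k j * (2 * u) ^ (k - 2 * j).toNat * s ^ j := by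
    intro M hM K hK
    refine Finset.sum_subset (Finset.range_mono hK) fun j _ hj => ?_
    rw [Finset.mem_range, not_lt] at hj
    rw [gegenbauerCoeff_of_lt (by omega), zero_mul, zero_mul]
  rw [homGegenbauer, key (k.toNat + 1) (by omega) _ (le_max_left _ N),
    key N hN _ (le_max_right (k.toNat + 1) _)]

theorem homGegenbauer_of_neg (μ : ℝ) {k : ℤ} (hk : k < 0) (u s : ℝ) :
    homGegenbauer μ k u s = 0 := by
  rw [homGegenbauer_eq_sum μ u s (N := 0) (by simpa using hk), Finset.sum_range_zero]

theorem homGegenbauer_zero {μ : ℝ} (hμ : 0 < μ) (u s : ℝ) : homGegenbauer μ 0 u s = 1 := by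
  simp [homGegenbauer, gegenbauerCoeff, (Real.Gamma_pos_of_pos hμ).ne']

/-- Each r^k splits as r^(k-2j) · (r²)^j. With r = sin θ_1 this absorbs the sine power of the
harmonic. -/
theorem pow_mul_gegenbauer (μ : ℝ) (k : ℕ) (r c : ℝ) :
    r ^ k * gegenbauer μ k c = homGegenbauer μ k (r * c) (r ^ 2) := by
  rw [homGegenbauer_eq_sum μ _ _ (N := k / 2 + 1) (by omega), gegenbauer, Finset.mul_sum]
  refine Finset.sum_congr rfl fun j hj => ?_
  rw [Finset.mem_range] at hj
  obtain ⟨a, rfl⟩ : ∃ a, k = a + 2 * j := ⟨k - 2 * j, by omega⟩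
  push_cast
  rw [gegenbauerCoeff_add, show ((a : ℤ) + 2 * j - 2 * j).toNat = a by omega,
    show a + 2 * j - 2 * j = a by omega, show μ + (a + 2 * j) - j = μ + a + j by ring]
  ring

theorem gegenbauer_eq (μ : ℝ) (k : ℕ) (t : ℝ) : gegenbauer μ k t = homGegenbauer μ k t 1 := by
  simpa using pow_mul_gegenbauer μ k 1 t

theorem gegenbauerCoeff_succ_param {μ : ℝ} (hμ : 0 < μ) (k : ℤ) (j : ℕ) :
    μ * gegenbauerCoeff (μ + 1) k j = (k - j + μ) * gegenbauerCoeff μ k j := by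
  rcases lt_or_ge k (2 * j) with h | h
  · simp [gegenbauerCoeff_of_lt h]
  obtain ⟨a, rfl⟩ : ∃ a : ℕ, k = a + 2 * j := ⟨(k - 2 * j).toNat, by omega⟩
  have hx : 0 < μ + a + j := by positivity
  have hG := (Real.Gamma_pos_of_pos hμ).ne'
  rw [gegenbauerCoeff_add, gegenbauerCoeff_add, show μ + 1 + a + j = (μ + a + j) + 1 by ring,
    Real.Gamma_add_one hx.ne', Real.Gamma_add_one hμ.ne']
  push_cast
  field_simp
  ring

theorem gegenbauerCoeff_pred {μ : ℝ} (hμ : 0 < μ) (k : ℤ) (j : ℕ) :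
    (k - 2 * j) * gegenbauerCoeff μ k j = μ * gegenbauerCoeff (μ + 1) (k - 1) j := by
  rcases lt_trichotomy k (2 * j) with h | h | h
  · rw [gegenbauerCoeff_of_lt h, gegenbauerCoeff_of_lt (by omega), mul_zero, mul_zero]
  · rw [gegenbauerCoeff_of_lt (k := k - 1) (by omega), h]
    push_cast
    ring
  obtain ⟨a, rfl⟩ : ∃ a : ℕ, k = (a + 1 : ℕ) + 2 * j := ⟨(k - 2 * j - 1).toNat, by omega⟩
  have hG := (Real.Gamma_pos_of_pos hμ).ne'
  rw [gegenbauerCoeff_add, show ((a + 1 : ℕ) : ℤ) + 2 * j - 1 = a + 2 * j by push_cast; ring,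
    gegenbauerCoeff_add, Real.Gamma_add_one hμ.ne', Nat.factorial_succ]
  push_cast
  rw [show μ + (a + 1) + j = μ + 1 + a + j by ring]
  field_simp
  ring

theorem gegenbauerCoeff_pred_pred {μ : ℝ} (hμ : 0 < μ) (k : ℤ) (j : ℕ) :
    (j + 1) * gegenbauerCoeff μ k (j + 1) = -(μ * gegenbauerCoeff (μ + 1) (k - 2) j) := by
  rcases lt_or_ge k (2 * (j + 1 : ℕ)) with h | h
  · rw [gegenbauerCoeff_of_lt h, gegenbauerCoeff_of_lt (by push_cast at h; omega)]
    ring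
  obtain ⟨a, rfl⟩ : ∃ a : ℕ, k = a + 2 * (j + 1 : ℕ) := ⟨(k - 2 * (j + 1 : ℕ)).toNat, by omega⟩
  have hG := (Real.Gamma_pos_of_pos hμ).ne'
  rw [gegenbauerCoeff_add, show (a : ℤ) + 2 * (j + 1 : ℕ) - 2 = a + 2 * j by push_cast; ring,
    gegenbauerCoeff_add, Real.Gamma_add_one hμ.ne', Nat.factorial_succ]
  push_cast
  rw [show μ + a + (j + 1) = μ + 1 + a + j by ring]
  field_simp
  ring

/-- The truncated exponent really drops by one when 2j ≤ k - 1; otherwise the coefficient is zero.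
-/
theorem gegenbauerCoeff_mul_pow (μ : ℝ) (k : ℤ) (j : ℕ) (u : ℝ) :
    gegenbauerCoeff μ (k - 1) j * (2 * u) ^ (k - 2 * j).toNat =
      gegenbauerCoeff μ (k - 1) j * (2 * u) ^ (k - 1 - 2 * j).toNat * (2 * u) := by
  rcases lt_or_ge (k - 1) (2 * j) with h | h
  · simp [gegenbauerCoeff_of_lt h]
  · rw [show (k - 2 * j).toNat = (k - 1 - 2 * j).toNat + 1 by omega, pow_succ]
    ring

/-! ### Relations between contiguous Gegenbauer polynomials -/

/-- With F_μ = (1 - 2uz + sz²)^(-μ), this compares coefficients of z^k in 2μ(1 - uz) F_{μ+1} = (z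
d/dz + 2μ) F_μ. -/
theorem homGegenbauer_param {μ : ℝ} (hμ : 0 < μ) (k : ℤ) (u s : ℝ) :
    2 * μ * (homGegenbauer (μ + 1) k u s - u * homGegenbauer (μ + 1) (k - 1) u s) =
      (k + 2 * μ) * homGegenbauer μ k u s := by
  have hN : k < 2 * (k.toNat + 1 : ℕ) := by omega
  rw [homGegenbauer_eq_sum _ u s hN, homGegenbauer_eq_sum _ u s hN,
    homGegenbauer_eq_sum (k := k - 1) _ u s (show _ < 2 * ((k.toNat + 1 : ℕ) : ℤ) by omega),
    Finset.mul_sum, Finset.mul_sum, ← Finset.sum_sub_distrib, Finset.mul_sum]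
  refine Finset.sum_congr rfl fun j _ => ?_
  linear_combination 2 * (2 * u) ^ (k - 2 * j).toNat * s ^ j * gegenbauerCoeff_succ_param hμ k j
    + (2 * u) ^ (k - 2 * j).toNat * s ^ j * gegenbauerCoeff_pred hμ k j
    + μ * s ^ j * gegenbauerCoeff_mul_pow (μ + 1) k j u

/-- This is the partial derivative in s, after the index shift j ↦ j + 1. -/
theorem sum_shift_gegenbauerCoeff {μ : ℝ} (hμ : 0 < μ) (k : ℤ) (u s : ℝ) :
    ∑ j ∈ Finset.range (k.toNat + 1),
      gegenbauerCoeff μ k j * (2 * u) ^ (k - 2 * j).toNat * (j * s ^ (j - 1)) =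
      -(μ * homGegenbauer (μ + 1) (k - 2) u s) := by
  rw [homGegenbauer_eq_sum (k := k - 2) _ u s (N := k.toNat) (by omega), Finset.sum_range_succ',
    Finset.mul_sum, ← Finset.sum_neg_distrib]
  simp only [Nat.cast_zero, zero_mul, mul_zero, add_zero]
  refine Finset.sum_congr rfl fun j _ => ?_
  rw [show k - 2 * ((j + 1 : ℕ) : ℤ) = k - 2 - 2 * j by push_cast; ring, Nat.add_sub_cancel]
  push_cast
  linear_combination (2 * u) ^ (k - 2 - 2 * j).toNat * s ^ j * gegenbauerCoeff_pred_pred hμ k j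

/-- This is half of the partial derivative in u; the other factor 2 comes from differentiating 2u.
-/
theorem sum_gegenbauerCoeff_deriv {μ : ℝ} (hμ : 0 < μ) (k : ℤ) (u s : ℝ) :
    ∑ j ∈ Finset.range (k.toNat + 1),
      gegenbauerCoeff μ k j *
        (((k - 2 * j).toNat : ℝ) * (2 * u) ^ ((k - 2 * j).toNat - 1)) * s ^ j =
      μ * homGegenbauer (μ + 1) (k - 1) u s := by
  rw [homGegenbauer_eq_sum (k := k - 1) _ u s (N := k.toNat + 1) (by omega), Finset.mul_sum]
  refine Finset.sum_congr rfl fun j _ => ?_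
  rcases lt_or_ge k (2 * j) with h | h
  · rw [gegenbauerCoeff_of_lt h, gegenbauerCoeff_of_lt (by omega)]
    ring
  have h1 : (((k - 2 * j).toNat : ℕ) : ℝ) = k - 2 * j := by
    have : (((k - 2 * j).toNat : ℕ) : ℤ) = k - 2 * j := by omega
    exact_mod_cast congrArg (Int.cast (R := ℝ)) this
  rw [h1, show (k - 2 * j).toNat - 1 = (k - 1 - 2 * j).toNat by omega]
  linear_combination (2 * u) ^ (k - 1 - 2 * j).toNat * s ^ j * gegenbauerCoeff_pred hμ k j

/-- Euler's relation u ∂_u + 2s ∂_s = k, since the polynomial is homogeneous of weight k when u has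
weight 1 and s weight 2. -/
theorem homGegenbauer_euler {μ : ℝ} (hμ : 0 < μ) (k : ℤ) (u s : ℝ) :
    k * homGegenbauer μ k u s =
      2 * μ * (u * homGegenbauer (μ + 1) (k - 1) u s - s * homGegenbauer (μ + 1) (k - 2) u s) := by
  have h1 := sum_gegenbauerCoeff_deriv hμ k u s
  have h2 := sum_shift_gegenbauerCoeff hμ k u s
  rw [show ∀ a b : ℝ, 2 * μ * (u * a - s * b) = 2 * u * (μ * a) + 2 * s * -(μ * b) by
    intros; ring, ← h1, ← h2, homGegenbauer, Finset.mul_sum, Finset.mul_sum, Finset.mul_sum,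
    ← Finset.sum_add_distrib]
  refine Finset.sum_congr rfl fun j _ => ?_
  rcases lt_or_ge k (2 * j) with h | h
  · rw [gegenbauerCoeff_of_lt h]
    ring
  obtain ⟨a, rfl⟩ : ∃ a : ℕ, k = a + 2 * j := ⟨(k - 2 * j).toNat, by omega⟩
  rw [show ((a : ℤ) + 2 * j - 2 * j).toNat = a by omega]
  have e : ∀ (x : ℝ) (a : ℕ), x * (a * x ^ (a - 1)) = a * x ^ a := by
    rintro x (_ | a)
    · simp
    · rw [Nat.add_sub_cancel, pow_succ]; ring
  push_cast
  linear_combination (-gegenbauerCoeff μ (a + 2 * j) j * s ^ j) * e (2 * u) a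
    - 2 * gegenbauerCoeff μ (a + 2 * j) j * (2 * u) ^ a * e s j

/-- The polynomials of parameter μ + 1 are eliminated from two Euler relations and two parameter
relations. -/
theorem homGegenbauer_recurrence {μ : ℝ} (hμ : 0 < μ) (k : ℤ) (u s : ℝ) :
    2 * (μ + k) * u * homGegenbauer μ k u s =
      (k + 1) * homGegenbauer μ (k + 1) u s +
        (2 * μ + k - 1) * s * homGegenbauer μ (k - 1) u s := by
  have h1 := homGegenbauer_euler hμ (k + 1) u s
  have h2 := homGegenbauer_euler hμ k u s
  have h3 := homGegenbauer_param hμ k u s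
  have h4 := homGegenbauer_param hμ (k - 1) u s
  rw [show k + 1 - 1 = k by ring, show k + 1 - 2 = k - 1 by ring] at h1
  rw [show k - 1 - 1 = k - 2 by ring] at h4
  push_cast at h1 h4
  linear_combination -h1 + u * h2 - u * h3 + s * h4

/-- Since 2ν C_{m-1}^{ν+1} is the derivative of C_m^ν, the left side is, up to sign and a power of 1
- t², the derivative of (1 - t²)^(ν-1/2) C_m^ν. It lowers the parameter and raises the degree. -/
theorem gegenbauer_ladder {ν : ℝ} (hν : 1 < ν) (m : ℤ) (t : ℝ) :
    (2 * ν - 1) * t * homGegenbauer ν m t 1 -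
        2 * ν * (1 - t ^ 2) * homGegenbauer (ν + 1) (m - 1) t 1 =
      (m + 1) * (m + 2 * ν - 1) / (2 * (ν - 1)) * homGegenbauer (ν - 1) (m + 1) t 1 := by
  have h1 := homGegenbauer_euler (by linarith : 0 < ν) (m + 1) t 1
  have h2 := homGegenbauer_param (by linarith : 0 < ν) m t 1
  have h3 := homGegenbauer_param (by linarith : 0 < ν - 1) (m + 1) t 1
  rw [show m + 1 - 1 = m by ring, show m + 1 - 2 = m - 1 by ring] at h1
  rw [show m + 1 - 1 = m by ring, show ν - 1 + 1 = ν by ring] at h3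
  push_cast at h1 h3
  have h0 : ν - 1 ≠ 0 := by linarith
  rw [div_mul_eq_mul_div, eq_div_iff (by positivity)]
  linear_combination -2 * (ν - 1) * h1 - 2 * (ν - 1) * t * h2 + (m + 1) * h3

/-! ### Differentiation along a curve -/

theorem hasDerivAt_homGegenbauer {μ : ℝ} (hμ : 0 < μ) (k : ℤ) {u s : ℝ → ℝ} {u' s' a : ℝ}
    (hu : HasDerivAt u u' a) (hs : HasDerivAt s s' a) :
    HasDerivAt (fun x => homGegenbauer μ k (u x) (s x))
      (2 * μ * homGegenbauer (μ + 1) (k - 1) (u a) (s a) * u' -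
        μ * homGegenbauer (μ + 1) (k - 2) (u a) (s a) * s') a := by
  have h := HasDerivAt.fun_sum (u := Finset.range (k.toNat + 1)) fun j _ =>
    (((hu.const_mul 2).pow (k - 2 * j).toNat).const_mul (gegenbauerCoeff μ k j)).mul (hs.pow j)
  refine HasDerivAt.congr_deriv (f := fun x => homGegenbauer μ k (u x) (s x)) h ?_
  rw [show ∀ x y : ℝ, 2 * μ * x * u' - μ * y * s' = 2 * u' * (μ * x) + s' * -(μ * y) by
    intros; ring, ← sum_gegenbauerCoeff_deriv hμ, ← sum_shift_gegenbauerCoeff hμ,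
    Finset.mul_sum, Finset.mul_sum, ← Finset.sum_add_distrib]
  refine Finset.sum_congr rfl fun j _ => ?_
  simp only [Pi.pow_apply]
  ring

/-- Along a rotation with `t' = -u`, the derivative of `C_m^ν(t) q` splits into two neighbours. -/
theorem hasDerivAt_homGegenbauer_mul {ν : ℝ} (hν : 1 < 2 * ν) (m : ℤ) {t q : ℝ → ℝ}
    {u qm qp a b : ℝ} (ht : HasDerivAt t (-u) 0) (hq : HasDerivAt q (a * t 0 * qm) 0)
    (hrec : (2 * ν - 1) * u * q 0 = b * qp + a * (1 - t 0 ^ 2) * qm) :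
    HasDerivAt (fun x => homGegenbauer ν m (t x) 1 * q x)
      (a / (2 * ν - 1) * qm * ((2 * ν - 1) * t 0 * homGegenbauer ν m (t 0) 1 -
          2 * ν * (1 - t 0 ^ 2) * homGegenbauer (ν + 1) (m - 1) (t 0) 1) -
        2 * ν * b / (2 * ν - 1) * homGegenbauer (ν + 1) (m - 1) (t 0) 1 * qp) 0 := by
  have h := (hasDerivAt_homGegenbauer (by linarith : 0 < ν) m ht
    (hasDerivAt_const (0 : ℝ) (1 : ℝ))).mul hq
  refine HasDerivAt.congr_deriv h ?_
  have h0 : 2 * ν - 1 ≠ 0 := by linarith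
  field_simp
  -- The product u · q 0 produced by t' = -u is replaced by its two-term expansion `hrec`.
  linear_combination (-2 * ν * homGegenbauer (ν + 1) (m - 1) (t 0) 1) * hrec

/-! ### Normalization constants and β -/

/-- The factor of `normConst n l k` belonging to `τ`, where `p = k_(τ-1)` and `q = k_τ`. -/
def normFactor (n τ p q : ℕ) : ℝ :=
  (2 : ℝ) ^ ((n : ℤ) - τ + 2 * q - 2) * ((p - q).factorial : ℝ) * ((n : ℝ) - τ + 2 * p) *
      Real.Gamma (((n : ℝ) - τ) / 2 + q) ^ 2 /
    (√Real.pi * ((n - τ + p + q - 1).factorial : ℝ))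

theorem normFactor_nonneg {n τ : ℕ} (h : τ ≤ n) (p q : ℕ) : 0 ≤ normFactor n τ p q := by
  have h' : (0 : ℝ) ≤ (n : ℝ) - τ := sub_nonneg.2 (Nat.cast_le.2 h)
  unfold normFactor
  positivity

theorem normConst_sq (n l : ℕ) (k : ℕ → ℤ) :
    normConst n l k ^ 2 = 1 / Real.Gamma (((n : ℝ) + 1) / 2) *
      ∏ τ ∈ Finset.Icc 1 (n - 1), normFactor n τ (absIndex l k (τ - 1)) (absIndex l k τ) := by
  refine Real.sq_sqrt (mul_nonneg ?_ (Finset.prod_nonneg fun τ hτ => ?_))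
  · exact div_nonneg zero_le_one (Real.Gamma_nonneg_of_nonneg (by positivity))
  · rw [Finset.mem_Icc] at hτ
    exact normFactor_nonneg (by omega) _ _

theorem normFactor_succ_right {n τ p q : ℕ} (hτ : τ < n) (hq : q < p) :
    normFactor n τ p (q + 1) * (((p : ℝ) - q) * (n - τ + p + q)) =
      normFactor n τ p q * ((n : ℝ) - τ + 2 * q) ^ 2 := by
  obtain ⟨m, rfl⟩ : ∃ m, n = τ + (m + 1) := ⟨n - τ - 1, by omega⟩
  obtain ⟨d, rfl⟩ : ∃ d, p = q + (d + 1) := ⟨p - q - 1, by omega⟩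
  have hz : ((τ + (m + 1) : ℕ) : ℤ) - τ + 2 * (q + 1 : ℕ) - 2 =
      ((τ + (m + 1) : ℕ) - τ + 2 * q - 2 : ℤ) + 2 := by push_cast; ring
  have hG : ((((τ + (m + 1) : ℕ) : ℝ) - τ) / 2 + (q + 1 : ℕ)) =
      (((τ + (m + 1) : ℕ) : ℝ) - τ) / 2 + q + 1 := by push_cast; ring
  have hpos : (((τ + (m + 1) : ℕ) : ℝ) - τ) / 2 + q ≠ 0 := by
    have : (((τ + (m + 1) : ℕ) : ℝ) - τ) / 2 + q = ((m : ℝ) + 1) / 2 + q := by push_cast; ring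
    rw [this]; positivity
  unfold normFactor
  rw [hz, hG, Real.Gamma_add_one hpos, zpow_add₀ two_ne_zero,
    show q + (d + 1) - (q + 1) = d by omega, show q + (d + 1) - q = d + 1 by omega,
    show τ + (m + 1) - τ + (q + (d + 1)) + (q + 1) - 1 = (m + 2 * q + d + 1) + 1 by omega,
    show τ + (m + 1) - τ + (q + (d + 1)) + q - 1 = m + 2 * q + d + 1 by omega,
    Nat.factorial_succ d, Nat.factorial_succ (m + 2 * q + d + 1)]
  have hπ : √Real.pi ≠ 0 := (Real.sqrt_pos.2 Real.pi_pos).ne'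
  rw [div_mul_eq_mul_div, div_mul_eq_mul_div, div_eq_div_iff (by positivity) (by positivity)]
  push_cast
  norm_num
  ring

theorem normFactor_succ_left {n τ p : ℕ} (hτ : τ < n) :
    normFactor n τ (p + 1) 0 * (((n : ℝ) - τ + 2 * p) * (n - τ + p)) =
      normFactor n τ p 0 * ((p + 1) * ((n : ℝ) - τ + 2 * p + 2)) := by
  obtain ⟨m, rfl⟩ : ∃ m, n = τ + (m + 1) := ⟨n - τ - 1, by omega⟩
  unfold normFactor
  rw [show p + 1 - 0 = p + 1 by omega, show p - 0 = p by omega,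
    show τ + (m + 1) - τ + (p + 1) + 0 - 1 = (m + p) + 1 by omega,
    show τ + (m + 1) - τ + p + 0 - 1 = m + p by omega,
    Nat.factorial_succ p, Nat.factorial_succ (m + p)]
  have hπ : √Real.pi ≠ 0 := (Real.sqrt_pos.2 Real.pi_pos).ne'
  rw [div_mul_eq_mul_div, div_mul_eq_mul_div, div_eq_div_iff (by positivity) (by positivity)]
  push_cast
  ring

theorem absIndex_firstIndex (l k τ : ℕ) :
    absIndex l (firstIndex k) τ = if τ = 0 then l else if τ = 1 then k else 0 := by
  unfold absIndex firstIndex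
  split_ifs <;> simp

theorem absIndex_firstIndex_neg (l : ℕ) (k : ℤ) :
    absIndex l (firstIndex (-k)) = absIndex l (firstIndex k) := by
  funext τ
  unfold absIndex firstIndex
  split_ifs <;> simp

theorem normConst_nonneg (n l : ℕ) (k : ℕ → ℤ) : 0 ≤ normConst n l k := Real.sqrt_nonneg _

theorem prod_Icc_eq {n : ℕ} (hn : 3 ≤ n) (f : ℕ → ℝ) :
    ∏ τ ∈ Finset.Icc 1 (n - 1), f τ = f 1 * (f 2 * ∏ τ ∈ Finset.Icc 3 (n - 1), f τ) := by
  rw [← Finset.mul_prod_Ioc_eq_prod_Icc (by omega), ← Finset.Icc_add_one_left_eq_Ioc,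
    ← Finset.mul_prod_Ioc_eq_prod_Icc (a := 1 + 1) (by omega), ← Finset.Icc_add_one_left_eq_Ioc,
    show 1 + 1 + 1 = 3 by rfl, show 1 + 1 = 2 by rfl]

/-- Raising k_1 changes only the factors τ = 1 (its lower index) and τ = 2 (its upper index); all
later factors have both indices 0. -/
theorem normConst_succ_sq {n l k : ℕ} (hn : 3 ≤ n) (hk : k < l) :
    normConst n l (firstIndex (k + 1 : ℕ)) ^ 2 *
        (((l : ℝ) - k) * (n - 1 + l + k) * ((n - 2 + 2 * k) * (n - 2 + k))) =
      normConst n l (firstIndex k) ^ 2 *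
        (((n : ℝ) - 1 + 2 * k) ^ 2 * ((k + 1) * (n + 2 * k))) := by
  have rest : ∀ k : ℕ, ∏ τ ∈ Finset.Icc 3 (n - 1),
      normFactor n τ (absIndex l (firstIndex k) (τ - 1)) (absIndex l (firstIndex k) τ) =
      ∏ τ ∈ Finset.Icc 3 (n - 1), normFactor n τ 0 0 := fun k => by
    refine Finset.prod_congr rfl fun τ hτ => ?_
    rw [Finset.mem_Icc] at hτ
    rw [absIndex_firstIndex, absIndex_firstIndex, if_neg (by omega), if_neg (by omega),
      if_neg (by omega), if_neg (by omega)]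
  have h1 := normFactor_succ_right (n := n) (τ := 1) (by omega) hk
  have h2 := normFactor_succ_left (n := n) (τ := 2) (p := k) (by omega)
  rw [normConst_sq, normConst_sq, prod_Icc_eq hn, prod_Icc_eq hn, rest, rest]
  simp only [absIndex_firstIndex, Nat.sub_self, if_true, one_ne_zero, if_false,
    Nat.add_one_sub_one, OfNat.ofNat_ne_zero, OfNat.ofNat_ne_one]
  push_cast at h1 h2 ⊢
  rw [show (n : ℝ) - 2 + 2 * k + 2 = n + 2 * k by ring] at h2
  generalize ∏ τ ∈ Finset.Icc 3 (n - 1), normFactor n τ 0 0 = R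
  generalize 1 / Real.Gamma (((n : ℝ) + 1) / 2) = G
  linear_combination
    G * R * normFactor n 2 (k + 1) 0 * ((n - 2 + 2 * k) * (n - 2 + k)) * h1 +
    G * R * normFactor n 1 l k * ((n : ℝ) - 1 + 2 * k) ^ 2 * h2

theorem normConst_two_succ_sq {l k : ℕ} (hk : k < l) :
    normConst 2 l (firstIndex (k + 1 : ℕ)) ^ 2 * (((l : ℝ) - k) * (l + k + 1)) =
      normConst 2 l (firstIndex k) ^ 2 * (2 * k + 1) ^ 2 := by
  have h1 := normFactor_succ_right (n := 2) (τ := 1) (by omega) hk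
  rw [normConst_sq, normConst_sq]
  simp only [Nat.add_one_sub_one, Finset.Icc_self, Finset.prod_singleton, absIndex_firstIndex,
    Nat.sub_self, if_true, one_ne_zero, if_false]
  push_cast at h1 ⊢
  linear_combination 1 / Real.Gamma (((2 : ℝ) + 1) / 2) * h1

theorem beta_nonneg (n l : ℕ) (k : ℤ) : 0 ≤ beta n l k := by
  unfold beta
  split_ifs <;> positivity

theorem beta_self (n l : ℕ) : beta n l l = 0 := by
  simp [beta, betaRadicand]

theorem beta_sq {n l k : ℕ} (hn : 3 ≤ n) (hk : k ≤ l) :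
    beta n l k ^ 2 = ((k + 1) * ((n : ℝ) - 2 + k) * (l - k) * (n - 1 + l + k)) /
      ((n - 2 + 2 * k) * (n + 2 * k)) := by
  have hn' : (3 : ℝ) ≤ n := by exact_mod_cast hn
  have hk' : (0 : ℝ) ≤ (l : ℝ) - k := sub_nonneg.2 (Nat.cast_le.2 hk)
  have e1 : (0 : ℝ) < n - 2 := by linarith
  have e2 : (0 : ℝ) < n - 1 := by linarith
  rw [beta, if_neg (by omega), if_neg (by omega)]
  have e : betaRadicand (((n : ℝ) - 1) / 2) l (k : ℤ) =
      ((k + 1) * ((n : ℝ) - 2 + k) * (l - k) * (n - 1 + l + k)) /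
      ((n - 2 + 2 * k) * (n + 2 * k)) := by
    unfold betaRadicand
    push_cast
    congr 1 <;> ring
  rw [e, Real.sq_sqrt (by positivity)]

theorem beta_two_sq {l k : ℕ} (hk : k ≤ l) :
    beta 2 l k ^ 2 = ((l : ℝ) - k) * (l + k + 1) / 4 := by
  have hk' : (0 : ℝ) ≤ (l : ℝ) - k := sub_nonneg.2 (Nat.cast_le.2 hk)
  rw [beta, if_neg (by omega), if_pos rfl, div_pow]
  push_cast
  rw [Real.sq_sqrt (by positivity)]
  norm_num

/-- Both sides are nonnegative, so it suffices to compare squares, where no root remains. -/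
theorem beta_mul_normConst_succ {n l k : ℕ} (hn : 3 ≤ n) (hk : k < l) :
    beta n l k * normConst n l (firstIndex (k + 1 : ℕ)) =
      normConst n l (firstIndex k) * (((n : ℝ) - 1 + 2 * k) * (k + 1) / (n - 2 + 2 * k)) := by
  have hn' : (3 : ℝ) ≤ n := by exact_mod_cast hn
  have e1 : (0 : ℝ) < n - 2 := by linarith
  have e2 : (0 : ℝ) < n - 1 := by linarith
  have h := normConst_succ_sq hn hk
  refine (sq_eq_sq₀ (mul_nonneg (beta_nonneg _ _ _) (normConst_nonneg _ _ _))
    (mul_nonneg (normConst_nonneg _ _ _) (by positivity))).1 ?_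
  rw [mul_pow, mul_pow, beta_sq hn hk.le]
  have e3 : (n : ℝ) - 2 + 2 * k ≠ 0 := by positivity
  rw [div_pow, div_mul_eq_mul_div, mul_div_assoc', div_eq_div_iff (by positivity) (by positivity)]
  linear_combination (k + 1 : ℝ) * (n - 2 + 2 * k) * h

/-- Multiply the preceding identity by β and insert the value of β²; the common factor k + 1
cancels. -/
theorem beta_mul_normConst {n l k : ℕ} (hn : 3 ≤ n) (hk : k < l) :
    beta n l k * normConst n l (firstIndex k) = normConst n l (firstIndex (k + 1 : ℕ)) *
      (((n : ℝ) - 2 + k) * (l - k) * (n - 1 + l + k) / ((n - 1 + 2 * k) * (n + 2 * k))) := by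
  have hn' : (3 : ℝ) ≤ n := by exact_mod_cast hn
  have e1 : (0 : ℝ) < n - 2 := by linarith
  have e2 : (0 : ℝ) < n - 1 := by linarith
  have e3 : (n : ℝ) - 2 + 2 * k ≠ 0 := by positivity
  have e4 : (n : ℝ) + 2 * k ≠ 0 := by positivity
  have e5 : (n : ℝ) - 1 + 2 * k ≠ 0 := by positivity
  have h := beta_mul_normConst_succ hn hk
  have hb := beta_sq hn hk.le
  field_simp at h hb ⊢
  refine mul_right_cancel₀ (b := (k + 1 : ℝ)) (by positivity) ?_
  linear_combination -(beta n l k * (n + 2 * k)) * h +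
    normConst n l (firstIndex (k + 1 : ℕ)) * hb

theorem beta_two_mul_normConst_succ {l k : ℕ} (hk : k < l) :
    beta 2 l k * normConst 2 l (firstIndex (k + 1 : ℕ)) =
      normConst 2 l (firstIndex k) * ((2 * k + 1) / 2) := by
  refine (sq_eq_sq₀ (mul_nonneg (beta_nonneg _ _ _) (normConst_nonneg _ _ _))
    (mul_nonneg (normConst_nonneg _ _ _) (by positivity))).1 ?_
  rw [mul_pow, mul_pow, beta_two_sq hk.le]
  linear_combination normConst_two_succ_sq hk / 4

theorem beta_two_mul_normConst {l k : ℕ} (hk : k < l) :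
    beta 2 l k * normConst 2 l (firstIndex k) = normConst 2 l (firstIndex (k + 1 : ℕ)) *
      (((l : ℝ) - k) * (l + k + 1) / (2 * (2 * k + 1))) := by
  have h := beta_two_mul_normConst_succ hk
  have hb := beta_two_sq hk.le
  field_simp at h hb ⊢
  linear_combination -2 * beta 2 l k * h + normConst 2 l (firstIndex (k + 1 : ℕ)) * hb

/-! ### The rotation in coordinates -/

theorem rotate_apply (n : ℕ) (Θ : ℝ) (x : EuclideanSpace ℝ (Fin (n + 1))) (i : Fin (n + 1)) :
    rotate n Θ x i = ∑ j, rotationMatrix n Θ i j * x j := rfl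

theorem coord_rotate_one {n : ℕ} (hn : 1 ≤ n) (Θ : ℝ) (x : EuclideanSpace ℝ (Fin (n + 1))) :
    coord n (rotate n Θ x) 1 = coord n x 1 * Real.cos Θ - coord n x 2 * Real.sin Θ := by
  obtain ⟨m, rfl⟩ : ∃ m, n = m + 1 := ⟨n - 1, by omega⟩
  have h1 : 1 ≤ 1 ∧ 1 ≤ m + 1 + 1 := by omega
  have h2 : 1 ≤ 2 ∧ 2 ≤ m + 1 + 1 := by omega
  rw [coord, coord, coord, dif_pos h1, dif_pos h1, dif_pos h2, rotate_apply,
    Fin.sum_univ_succ,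
    Fin.sum_univ_succ, Finset.sum_eq_zero]
  · simp [rotationMatrix]
    ring
  · intro i _
    have : ¬ ((0 : Fin (m + 1 + 1)) = i.succ.succ) := (Fin.succ_ne_zero _).symm
    simp [rotationMatrix, this]

theorem coord_rotate_two {n : ℕ} (hn : 1 ≤ n) (Θ : ℝ) (x : EuclideanSpace ℝ (Fin (n + 1))) :
    coord n (rotate n Θ x) 2 = coord n x 1 * Real.sin Θ + coord n x 2 * Real.cos Θ := by
  obtain ⟨m, rfl⟩ : ∃ m, n = m + 1 := ⟨n - 1, by omega⟩
  have h1 : 1 ≤ 1 ∧ 1 ≤ m + 1 + 1 := by omega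
  have h2 : 1 ≤ 2 ∧ 2 ≤ m + 1 + 1 := by omega
  rw [coord, coord, coord, dif_pos h1, dif_pos h2, dif_pos h2, rotate_apply,
    Fin.sum_univ_succ,
    Fin.sum_univ_succ, Finset.sum_eq_zero]
  · simp [rotationMatrix]
    ring
  · intro i _
    have : ¬ ((1 : Fin (m + 1 + 1)) = i.succ.succ) := by
      simp [Fin.ext_iff]
    simp [rotationMatrix, this]

theorem coord_rotate_of_three_le {n j : ℕ} (hj : 3 ≤ j) (Θ : ℝ)
    (x : EuclideanSpace ℝ (Fin (n + 1))) : coord n (rotate n Θ x) j = coord n x j := by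
  unfold coord
  split_ifs with h
  · have h0 : ¬ j - 1 = 0 := by omega
    have h1 : ¬ j - 1 = 1 := by omega
    simp [rotate_apply, rotationMatrix, h0, h1]
  · rfl

theorem coord_rotate_zero_one {n : ℕ} (hn : 1 ≤ n) (x : EuclideanSpace ℝ (Fin (n + 1))) :
    coord n (rotate n 0 x) 1 = coord n x 1 := by
  simp [coord_rotate_one hn]

theorem coord_rotate_zero_two {n : ℕ} (hn : 1 ≤ n) (x : EuclideanSpace ℝ (Fin (n + 1))) :
    coord n (rotate n 0 x) 2 = coord n x 2 := by
  simp [coord_rotate_two hn]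

theorem norm_sq_eq {n : ℕ} (hn : 1 ≤ n) (x : EuclideanSpace ℝ (Fin (n + 1))) :
    ‖x‖ ^ 2 = coord n x 1 ^ 2 + (coord n x 2 ^ 2 + tailNorm n x 3 ^ 2) := by
  rw [← tailNorm_one, tailNorm_sq n x (by omega), tailNorm_sq n x (by omega : 1 + 1 ≤ n + 1)]

theorem norm_rotate {n : ℕ} (hn : 1 ≤ n) (Θ : ℝ) (x : EuclideanSpace ℝ (Fin (n + 1))) :
    ‖rotate n Θ x‖ = ‖x‖ := by
  refine (sq_eq_sq₀ (norm_nonneg _) (norm_nonneg _)).1 ?_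
  have h : tailNorm n (rotate n Θ x) 3 = tailNorm n x 3 := by
    unfold tailNorm
    congr 1
    refine Finset.sum_congr rfl fun j hj => ?_
    rw [coord_rotate_of_three_le (Finset.mem_Icc.1 hj).1]
  rw [norm_sq_eq hn, norm_sq_eq hn, h, coord_rotate_one hn, coord_rotate_two hn]
  linear_combination (coord n x 1 ^ 2 + coord n x 2 ^ 2) * Real.sin_sq_add_cos_sq Θ

theorem hasDerivAt_coord_rotate_one {n : ℕ} (hn : 1 ≤ n) (x : EuclideanSpace ℝ (Fin (n + 1))) :
    HasDerivAt (fun Θ => coord n (rotate n Θ x) 1) (-coord n x 2) 0 := by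
  simp only [coord_rotate_one hn]
  simpa using ((Real.hasDerivAt_cos 0).const_mul (coord n x 1)).fun_sub
    ((Real.hasDerivAt_sin 0).const_mul (coord n x 2))

theorem hasDerivAt_coord_rotate_two {n : ℕ} (hn : 1 ≤ n) (x : EuclideanSpace ℝ (Fin (n + 1))) :
    HasDerivAt (fun Θ => coord n (rotate n Θ x) 2) (coord n x 1) 0 := by
  simp only [coord_rotate_two hn]
  simpa using ((Real.hasDerivAt_sin 0).const_mul (coord n x 1)).fun_add
    ((Real.hasDerivAt_cos 0).const_mul (coord n x 2))

theorem cos_polarAngle_one {n : ℕ} {x : EuclideanSpace ℝ (Fin (n + 1))} (hx : ‖x‖ = 1) :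
    Real.cos (polarAngle n x 1) = coord n x 1 := by
  simpa [tailNorm_one, hx] using tailNorm_mul_cos n x (show 1 ≤ n + 1 by omega)

theorem sin_polarAngle_one {n : ℕ} {x : EuclideanSpace ℝ (Fin (n + 1))} (hx : ‖x‖ = 1) :
    Real.sin (polarAngle n x 1) = tailNorm n x 2 := by
  simpa [tailNorm_one, hx] using tailNorm_mul_sin n x (show 1 ≤ n + 1 by omega)

theorem tailNorm_two_sq {n : ℕ} {x : EuclideanSpace ℝ (Fin (n + 1))} (hx : ‖x‖ = 1) :
    tailNorm n x 2 ^ 2 = 1 - coord n x 1 ^ 2 := by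
  have h := tailNorm_sq n x (show 1 ≤ n + 1 by omega)
  rw [tailNorm_one, hx] at h
  linear_combination -h

/-! ### The case n ≥ 3 -/

theorem gegenbauer_zero {μ : ℝ} (hμ : 0 < μ) (t : ℝ) : gegenbauer μ 0 t = 1 := by
  rw [gegenbauer_eq, Nat.cast_zero, homGegenbauer_zero hμ]

/-- `Y_l^(k, 0, …, 0)` without its normalization, as a polynomial in the first two coordinates. -/
def axialPolynomial (n l k : ℕ) (t u : ℝ) : ℝ :=
  homGegenbauer (((n : ℝ) - 1) / 2 + k) ((l : ℤ) - k) t 1 *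
    homGegenbauer (((n : ℝ) - 2) / 2) k u (1 - t ^ 2)

/-- The factors with τ ≥ 3 equal 1, and the phase is trivial because k_(n-1) = 0 when n ≥ 3. The
identity sin θ_1 cos θ_2 = x_2 also holds where θ_2 is not unique, so no point of the sphere is
exceptional. -/
theorem harmonic_firstIndex {n l k : ℕ} (hn : 3 ≤ n) (hk : k ≤ l)
    {x : EuclideanSpace ℝ (Fin (n + 1))} (hx : ‖x‖ = 1) :
    harmonic n l (firstIndex k) x =
      ((normConst n l (firstIndex k) * axialPolynomial n l k (coord n x 1) (coord n x 2) : ℝ) :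
        ℂ) := by
  have hI : IsIndex n l (firstIndex k) := by
    refine ⟨fun τ h1 _ => ?_, fun τ _ _ => ?_⟩
    · rw [absIndex_firstIndex, absIndex_firstIndex]
      split_ifs <;> omega
    · unfold firstIndex
      split_ifs <;> omega
  rw [harmonic, if_pos hI, harmonicAngles, prod_Icc_eq hn, Finset.prod_eq_one]
  · have h0 : firstIndex k (n - 1) = 0 := if_neg (by omega)
    have h2 := tailNorm_mul_cos n x (show 2 ≤ n + 1 by omega)
    have h3 := pow_mul_gegenbauer (((n : ℝ) - 2) / 2) k (tailNorm n x 2)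
      (Real.cos (polarAngle n x 2))
    rw [h2, tailNorm_two_sq hx] at h3
    simp only [absIndex_firstIndex, h0, Nat.sub_self, if_true, one_ne_zero, if_false,
      Nat.add_one_sub_one, OfNat.ofNat_ne_zero, OfNat.ofNat_ne_one, Int.cast_zero, mul_zero,
      zero_mul, Complex.exp_zero, mul_one, cos_polarAngle_one hx, sin_polarAngle_one hx, pow_zero,
      Nat.sub_zero, Nat.cast_zero, add_zero, Nat.cast_one, Nat.cast_ofNat]
    rw [axialPolynomial, ← h3, gegenbauer_eq _ (l - k), Nat.cast_sub hk]
    congr 1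
    ring
  · intro τ hτ
    rw [Finset.mem_Icc] at hτ
    rw [absIndex_firstIndex, absIndex_firstIndex, if_neg (by omega), if_neg (by omega),
      if_neg (by omega), if_neg (by omega), Nat.sub_self, gegenbauer_zero, pow_zero, mul_one]
    have : (τ : ℝ) < n := Nat.cast_lt.2 (by omega)
    push_cast
    linarith

theorem harmonic_firstIndex_neg_one {n l : ℕ} (hn : 3 ≤ n)
    (x : EuclideanSpace ℝ (Fin (n + 1))) : harmonic n l (firstIndex (-1)) x = 0 := by
  refine if_neg fun h => ?_
  have := h.2 1 le_rfl (by omega)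
  simp [firstIndex] at this

theorem hasDerivAt_axialPolynomial {n l k : ℕ} (hn : 3 ≤ n) {t u : ℝ → ℝ}
    (ht : HasDerivAt t (-u 0) 0) (hu : HasDerivAt u (t 0) 0) :
    HasDerivAt (fun Θ => axialPolynomial n l k (t Θ) (u Θ))
      (((n : ℝ) - 3 + k) / (n - 2 + 2 * k) *
          homGegenbauer (((n : ℝ) - 2) / 2) (k - 1) (u 0) (1 - t 0 ^ 2) *
          ((n - 2 + 2 * k) * t 0 *
            homGegenbauer (((n : ℝ) - 1) / 2 + k) ((l : ℤ) - k) (t 0) 1 -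
          (n - 1 + 2 * k) * (1 - t 0 ^ 2) *
            homGegenbauer (((n : ℝ) - 1) / 2 + k + 1) ((l : ℤ) - k - 1) (t 0) 1) -
        ((n : ℝ) - 1 + 2 * k) * (k + 1) / (n - 2 + 2 * k) *
          axialPolynomial n l (k + 1) (t 0) (u 0)) 0 := by
  have hn' : (3 : ℝ) ≤ n := by exact_mod_cast hn
  have hk : (0 : ℝ) ≤ k := Nat.cast_nonneg k
  have hμ : (0 : ℝ) < ((n : ℝ) - 2) / 2 := by linarith
  have hs : HasDerivAt (fun Θ => 1 - t Θ ^ 2) (2 * t 0 * u 0) 0 := by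
    have h := (ht.pow 2).const_sub 1
    refine HasDerivAt.congr_deriv h ?_
    simp
  have hq := hasDerivAt_homGegenbauer hμ k hu hs
  -- With s' = 2tu the chain rule yields 2μt (C_{k-1}^{μ+1} - u C_{k-2}^{μ+1}), which this relation
  -- contracts to (2μ + k - 1) t C_{k-1}^μ; hence a = n - 3 + k.
  have hp := homGegenbauer_param hμ (k - 1) (u 0) (1 - t 0 ^ 2)
  rw [show (k : ℤ) - 1 - 1 = k - 2 by ring] at hp
  push_cast at hp
  have hr := homGegenbauer_recurrence hμ k (u 0) (1 - t 0 ^ 2)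
  push_cast at hr
  have h := hasDerivAt_homGegenbauer_mul (ν := ((n : ℝ) - 1) / 2 + k) (by linarith) ((l : ℤ) - k)
    (u := u 0) (qm := homGegenbauer (((n : ℝ) - 2) / 2) (k - 1) (u 0) (1 - t 0 ^ 2))
    (qp := homGegenbauer (((n : ℝ) - 2) / 2) (k + 1) (u 0) (1 - t 0 ^ 2))
    (a := (n : ℝ) - 3 + k) (b := k + 1) ht
    (hq.congr_deriv (by linear_combination t 0 * hp)) (by linear_combination hr)
  refine HasDerivAt.congr_deriv h ?_
  unfold axialPolynomial
  push_cast
  rw [show ((n : ℝ) - 1) / 2 + (k + 1) = ((n : ℝ) - 1) / 2 + k + 1 by ring,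
    show (l : ℤ) - (k + 1) = l - k - 1 by ring,
    show 2 * (((n : ℝ) - 1) / 2 + k) = n - 1 + 2 * k by ring,
    show (n : ℝ) - 1 + 2 * k - 1 = n - 2 + 2 * k by ring]
  ring

theorem axialPolynomial_of_lt {n l k : ℕ} (h : l < k) (t u : ℝ) :
    axialPolynomial n l k t u = 0 := by
  rw [axialPolynomial, homGegenbauer_of_neg _ (by omega), zero_mul]

/-- The ladder relation with ν = (n-1)/2 + k + 1 and m = l - k - 1 identifies the lower neighbour.
-/
theorem axialPolynomial_lower {n l k : ℕ} (hn : 3 ≤ n) (t u : ℝ) :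
    ((n : ℝ) - 3 + (k + 1 : ℕ)) / (n - 2 + 2 * (k + 1 : ℕ)) *
        homGegenbauer (((n : ℝ) - 2) / 2) ((k + 1 : ℕ) - 1) u (1 - t ^ 2) *
        ((n - 2 + 2 * (k + 1 : ℕ)) * t *
          homGegenbauer (((n : ℝ) - 1) / 2 + (k + 1 : ℕ)) ((l : ℤ) - (k + 1 : ℕ)) t 1 -
        (n - 1 + 2 * (k + 1 : ℕ)) * (1 - t ^ 2) *
          homGegenbauer (((n : ℝ) - 1) / 2 + (k + 1 : ℕ) + 1) ((l : ℤ) - (k + 1 : ℕ) - 1) t 1) =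
      ((n : ℝ) - 2 + k) * (l - k) * (n - 1 + l + k) / ((n - 1 + 2 * k) * (n + 2 * k)) *
        axialPolynomial n l k t u := by
  have hn' : (3 : ℝ) ≤ n := by exact_mod_cast hn
  have hk : (0 : ℝ) ≤ k := Nat.cast_nonneg k
  have h := gegenbauer_ladder (ν := ((n : ℝ) - 1) / 2 + (k + 1 : ℕ)) (by push_cast; linarith)
    ((l : ℤ) - (k + 1 : ℕ)) t
  rw [show (l : ℤ) - (k + 1 : ℕ) + 1 = l - k by push_cast; ring,
    show ((n : ℝ) - 1) / 2 + (k + 1 : ℕ) - 1 = ((n : ℝ) - 1) / 2 + k by push_cast; ring,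
    show 2 * (((n : ℝ) - 1) / 2 + (k + 1 : ℕ)) = n - 1 + 2 * (k + 1 : ℕ) by ring,
    show (n : ℝ) - 1 + 2 * (k + 1 : ℕ) - 1 = n - 2 + 2 * (k + 1 : ℕ) by ring] at h
  rw [h, axialPolynomial, show ((k + 1 : ℕ) : ℤ) - 1 = k by push_cast; ring]
  push_cast
  have e1 : (n : ℝ) - 2 + 2 * (k + 1) ≠ 0 := by linarith
  have e2 : (n : ℝ) - 1 + 2 * k ≠ 0 := by linarith
  have e3 : (n : ℝ) + 2 * k ≠ 0 := by linarith
  have e4 : 2 * (((n : ℝ) - 1) / 2 + k) ≠ 0 := by linarith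
  rw [show (n : ℝ) - 2 + 2 * (k + 1) = n + 2 * k by ring] at *
  rw [show 2 * (((n : ℝ) - 1) / 2 + k) = n - 1 + 2 * k by ring] at *
  field_simp
  ring

theorem hasDerivAt_harmonic_firstIndex {n l k : ℕ} (hn : 3 ≤ n) (hk : k ≤ l)
    {x : EuclideanSpace ℝ (Fin (n + 1))} (hx : ‖x‖ = 1) :
    HasDerivAt (fun Θ : ℝ => harmonic n l (firstIndex k) (rotate n Θ x))
      ((beta n l ((k : ℤ) - 1) : ℂ) * harmonic n l (firstIndex ((k : ℤ) - 1)) x -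
        (beta n l k : ℂ) * harmonic n l (firstIndex ((k : ℤ) + 1)) x) 0 := by
  have h1 : 1 ≤ n := by omega
  have hΘ : ∀ Θ, harmonic n l (firstIndex k) (rotate n Θ x) = _ := fun Θ =>
    harmonic_firstIndex hn hk ((norm_rotate h1 Θ x).trans hx)
  simp only [hΘ]
  have c1 : coord n (rotate n 0 x) 1 = coord n x 1 := coord_rotate_zero_one h1 x
  have c2 : coord n (rotate n 0 x) 2 = coord n x 2 := coord_rotate_zero_two h1 x
  have h := ((hasDerivAt_axialPolynomial (l := l) (k := k) hn
    (t := fun Θ => coord n (rotate n Θ x) 1) (u := fun Θ => coord n (rotate n Θ x) 2)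
    ((hasDerivAt_coord_rotate_one h1 x).congr_deriv (by rw [c2]))
    ((hasDerivAt_coord_rotate_two h1 x).congr_deriv c1.symm)).const_mul
      (normConst n l (firstIndex k))).ofReal_comp
  refine HasDerivAt.congr_deriv h ?_
  rw [c1, c2, mul_sub, Complex.ofReal_sub]
  have up : normConst n l (firstIndex k) * (((n : ℝ) - 1 + 2 * k) * (k + 1) / (n - 2 + 2 * k) *
      axialPolynomial n l (k + 1) (coord n x 1) (coord n x 2)) =
      (beta n l k : ℂ) * harmonic n l (firstIndex ((k : ℤ) + 1)) x := by
    -- At the top index k = l both sides vanish: β_{l,l} = 0, and the polynomial has a factor of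
    -- degree -1.
    rcases hk.lt_or_eq with hk | rfl
    · have e := harmonic_firstIndex hn (Nat.succ_le_iff.2 hk) hx
      push_cast at e
      rw [e]
      have := congrArg (Complex.ofReal) (beta_mul_normConst_succ hn hk)
      push_cast at this ⊢
      linear_combination
        -(axialPolynomial n l (k + 1) (coord n x 1) (coord n x 2) : ℂ) * this
    · rw [beta_self, axialPolynomial_of_lt (Nat.lt_succ_self k)]
      simp
  have down : ((normConst n l (firstIndex k) * (((n : ℝ) - 3 + k) / (n - 2 + 2 * k) *
          homGegenbauer (((n : ℝ) - 2) / 2) (k - 1) (coord n x 2) (1 - coord n x 1 ^ 2) *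
          ((n - 2 + 2 * k) * coord n x 1 *
            homGegenbauer (((n : ℝ) - 1) / 2 + k) ((l : ℤ) - k) (coord n x 1) 1 -
          (n - 1 + 2 * k) * (1 - coord n x 1 ^ 2) *
            homGegenbauer (((n : ℝ) - 1) / 2 + k + 1) ((l : ℤ) - k - 1) (coord n x 1) 1)) : ℝ) :
            ℂ) =
      (beta n l ((k : ℤ) - 1) : ℂ) * harmonic n l (firstIndex ((k : ℤ) - 1)) x := by
    -- At k = 0 the lower term vanishes: its homogenized factor has degree -1, and the index (-1, 0,
    -- …, 0) is not admissible.
    rcases k with _ | k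
    · rw [Nat.cast_zero, zero_sub, harmonic_firstIndex_neg_one hn,
        homGegenbauer_of_neg _ (by norm_num)]
      simp
    · rw [axialPolynomial_lower hn, show ((k + 1 : ℕ) : ℤ) - 1 = k by push_cast; ring,
        harmonic_firstIndex hn (by omega) hx, ← Complex.ofReal_mul, ← mul_assoc, ← mul_assoc,
        beta_mul_normConst hn (by omega)]
  rw [down, ← up]
  push_cast
  ring

/-! ### The two-dimensional sphere -/

/-- `Ỹ_l^k` on the two-dimensional sphere without its normalization, as a polynomial in the
coordinates. -/
def axialPolynomialTwo (l k : ℕ) (t u v : ℝ) : ℝ :=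
  homGegenbauer (1 / 2 + k) ((l : ℤ) - k) t 1 * (2 * ((⟨u, v⟩ : ℂ) ^ k).re)

theorem tailNorm_two_two (x : EuclideanSpace ℝ (Fin (2 + 1))) :
    tailNorm 2 x 2 = ‖(⟨coord 2 x 2, coord 2 x 3⟩ : ℂ)‖ := by
  rw [tailNorm, Complex.norm_def, Complex.normSq_mk, Finset.sum_Icc_succ_top (by omega)]
  simp [sq]

theorem harmonic_two {l : ℕ} {k : ℤ} (hk : k.natAbs ≤ l)
    {x : EuclideanSpace ℝ (Fin (2 + 1))} (hx : ‖x‖ = 1) :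
    harmonic 2 l (firstIndex k) x =
      normConst 2 l (firstIndex k) *
        homGegenbauer (1 / 2 + k.natAbs) ((l : ℤ) - k.natAbs) (coord 2 x 1) 1 *
        (tailNorm 2 x 2 ^ k.natAbs * Complex.exp (Complex.I * k * azimuth 2 x)) := by
  have a0 : absIndex l (firstIndex k) 0 = l := if_pos rfl
  have a1 : absIndex l (firstIndex k) 1 = k.natAbs := by simp [absIndex, firstIndex]
  have hI : IsIndex 2 l (firstIndex k) := by
    refine ⟨fun τ h1 h2 => ?_, fun τ h1 h2 => by omega⟩
    obtain rfl : τ = 1 := by omega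
    rwa [a1, Nat.sub_self, a0]
  rw [harmonic, if_pos hI, harmonicAngles, Nat.add_one_sub_one, Finset.Icc_self,
    Finset.prod_singleton, a1, Nat.sub_self, a0, cos_polarAngle_one hx, sin_polarAngle_one hx,
    gegenbauer_eq, Nat.cast_sub hk, show firstIndex k 1 = k from if_pos rfl,
    show (((2 : ℕ) : ℝ) - ((1 : ℕ) : ℝ)) / 2 = 1 / 2 by norm_num]
  push_cast
  ring

/-- With z = x_2 + i x_3 one has sin θ_1 = |z|, so sin^k θ_1 e^{±ikφ} are z^k and its conjugate,
with sum 2 Re z^k. The constants for k and -k agree because only |k| enters them. -/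
theorem symHarmonic_eq {l k : ℕ} (hk : k ≤ l)
    {x : EuclideanSpace ℝ (Fin (2 + 1))} (hx : ‖x‖ = 1) :
    symHarmonic l k x =
      ((normConst 2 l (firstIndex k) *
        axialPolynomialTwo l k (coord 2 x 1) (coord 2 x 2) (coord 2 x 3) : ℝ) : ℂ) := by
  have hA : normConst 2 l (firstIndex (-k)) = normConst 2 l (firstIndex k) := by
    unfold normConst
    rw [absIndex_firstIndex_neg]
  have hz := Complex.norm_mul_exp_arg_mul_I ⟨coord 2 x 2, coord 2 x 3⟩
  set z : ℂ := ⟨coord 2 x 2, coord 2 x 3⟩ with hzdef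
  have hφ : azimuth 2 x = z.arg := rfl
  have hpos : (‖z‖ : ℂ) ^ k * Complex.exp (Complex.I * (k : ℤ) * z.arg) = z ^ k := by
    conv_rhs => rw [← hz, mul_pow, ← Complex.exp_nat_mul]
    push_cast
    ring_nf
  have hneg : (‖z‖ : ℂ) ^ k * Complex.exp (Complex.I * (-k : ℤ) * z.arg) =
      (starRingEnd ℂ) (z ^ k) := by
    rw [← hpos, map_mul, map_pow, Complex.conj_ofReal, ← Complex.exp_conj, map_mul, map_mul,
      Complex.conj_I, Complex.conj_ofReal, map_intCast]
    push_cast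
    ring_nf
  rw [symHarmonic, if_pos (by omega), harmonic_two (by omega) hx, harmonic_two (by omega) hx, hA,
    Int.natAbs_neg, Int.natAbs_natCast, tailNorm_two_two, ← hzdef, hφ, hpos, hneg,
    axialPolynomialTwo, ← hzdef]
  have h := Complex.add_conj (z ^ k)
  push_cast at h ⊢
  linear_combination (normConst 2 l (firstIndex k) : ℂ) *
    homGegenbauer (1 / 2 + k) ((l : ℤ) - k) (coord 2 x 1) 1 * h

theorem symHarmonic_of_lt {l k : ℕ} (h : l < k) (x : EuclideanSpace ℝ (Fin (2 + 1))) :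
    symHarmonic l k x = 0 := if_neg (by omega)

theorem hasDerivAt_re_pow (k : ℕ) {u : ℝ → ℝ} {t v : ℝ} (hu : HasDerivAt u t 0) :
    HasDerivAt (fun Θ => ((⟨u Θ, v⟩ : ℂ) ^ k).re) (k * ((⟨u 0, v⟩ : ℂ) ^ (k - 1)).re * t) 0 := by
  have hz : HasDerivAt (fun Θ => (⟨u Θ, v⟩ : ℂ)) (t : ℂ) 0 := by
    have h := hu.ofReal_comp.add_const ((v : ℂ) * Complex.I)
    simpa only [← Complex.mk_eq_add_mul_I] using h
  have h := (Complex.reCLM.hasFDerivAt.comp_hasDerivAt (0 : ℝ) (hz.pow k))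
  refine HasDerivAt.congr_deriv h ?_
  rw [Complex.reCLM_apply, Complex.re_mul_ofReal, ← Complex.ofReal_natCast, Complex.re_ofReal_mul]

/-- The second factor is the constant 2, so only C_l^{1/2}(t) is differentiated and there is no
lower neighbour. -/
theorem hasDerivAt_axialPolynomialTwo_zero (l : ℕ) {t u : ℝ → ℝ} (v : ℝ)
    (ht : HasDerivAt t (-u 0) 0) :
    HasDerivAt (fun Θ => axialPolynomialTwo l 0 (t Θ) (u Θ) v)
      (-axialPolynomialTwo l 1 (t 0) (u 0) v) 0 := by
  have h := (hasDerivAt_homGegenbauer (μ := 1 / 2 + (0 : ℕ)) (by norm_num) ((l : ℤ) - (0 : ℕ)) ht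
    (hasDerivAt_const (0 : ℝ) (1 : ℝ))).mul_const (2 * (1 : ℝ))
  simp only [axialPolynomialTwo, pow_zero, Complex.one_re, pow_one]
  refine HasDerivAt.congr_deriv h ?_
  rw [show (1 / 2 : ℝ) + (0 : ℕ) + 1 = 1 / 2 + (1 : ℕ) by norm_num,
    show (l : ℤ) - (0 : ℕ) - 1 = l - (1 : ℕ) by push_cast; ring]
  push_cast
  ring

theorem hasDerivAt_axialPolynomialTwo_succ (l k : ℕ) {t u : ℝ → ℝ} {v : ℝ}
    (ht : HasDerivAt t (-u 0) 0) (hu : HasDerivAt u (t 0) 0) (hv : u 0 ^ 2 + v ^ 2 = 1 - t 0 ^ 2) :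
    HasDerivAt (fun Θ => axialPolynomialTwo l (k + 1) (t Θ) (u Θ) v)
      (((l : ℝ) - k) * (l + k + 1) / (2 * (2 * k + 1)) * axialPolynomialTwo l k (t 0) (u 0) v -
        (2 * (k + 1 : ℕ) + 1) / 2 * axialPolynomialTwo l (k + 2) (t 0) (u 0) v) 0 := by
  have hk : (0 : ℝ) ≤ k := Nat.cast_nonneg k
  -- The Chebyshev-type recurrence, from z + z̄ = 2u and z z̄ = u² + v² = 1 - t².
  have hrec : 2 * u 0 * ((⟨u 0, v⟩ : ℂ) ^ (k + 1)).re =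
      ((⟨u 0, v⟩ : ℂ) ^ (k + 2)).re + (1 - t 0 ^ 2) * ((⟨u 0, v⟩ : ℂ) ^ k).re := by
    rw [← hv, pow_succ _ (k + 1), pow_succ]
    simp only [Complex.mul_re, Complex.mul_im]
    ring
  have h := hasDerivAt_homGegenbauer_mul (ν := 1 / 2 + (k + 1 : ℕ)) (by push_cast; linarith)
    ((l : ℤ) - (k + 1 : ℕ)) (u := u 0) (qm := 2 * ((⟨u 0, v⟩ : ℂ) ^ k).re)
    (qp := 2 * ((⟨u 0, v⟩ : ℂ) ^ (k + 2)).re) (a := k + 1) (b := k + 1) ht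
    (((hasDerivAt_re_pow (k + 1) (v := v) hu).const_mul 2).congr_deriv (by
      rw [Nat.add_sub_cancel]; push_cast; ring))
    (by push_cast; linear_combination 2 * (k + 1 : ℝ) * hrec)
  refine HasDerivAt.congr_deriv h ?_
  have hl := gegenbauer_ladder (ν := 1 / 2 + (k + 1 : ℕ)) (by push_cast; linarith)
    ((l : ℤ) - (k + 1 : ℕ)) (t 0)
  rw [hl, axialPolynomialTwo, axialPolynomialTwo,
    show (1 / 2 : ℝ) + (k + 1 : ℕ) - 1 = 1 / 2 + k by push_cast; ring,
    show (1 / 2 : ℝ) + (k + 1 : ℕ) + 1 = 1 / 2 + (k + 2 : ℕ) by push_cast; ring,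
    show (l : ℤ) - (k + 1 : ℕ) + 1 = l - k by push_cast; ring,
    show (l : ℤ) - (k + 1 : ℕ) - 1 = l - (k + 2 : ℕ) by push_cast; ring]
  push_cast
  have e1 : 2 * (k : ℝ) + 1 ≠ 0 := by linarith
  have e2 : (k : ℝ) + 1 ≠ 0 := by linarith
  rw [show 2 * (1 / 2 + ((k : ℝ) + 1)) - 1 = 2 * (k + 1) by ring,
    show 2 * (1 / 2 + (k : ℝ)) = 2 * k + 1 by ring]
  field_simp
  ring

theorem hasDerivAt_symHarmonic_of_axialPolynomialTwo {l k : ℕ} (hk : k ≤ l)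
    {x : EuclideanSpace ℝ (Fin (2 + 1))} (hx : ‖x‖ = 1) {d : ℝ}
    (h : HasDerivAt (fun Θ => axialPolynomialTwo l k (coord 2 (rotate 2 Θ x) 1)
      (coord 2 (rotate 2 Θ x) 2) (coord 2 x 3)) d 0) :
    HasDerivAt (fun Θ : ℝ => symHarmonic l k (rotate 2 Θ x))
      ((normConst 2 l (firstIndex k) * d : ℝ) : ℂ) 0 := by
  have hΘ : ∀ Θ, symHarmonic l k (rotate 2 Θ x) = _ := fun Θ =>
    symHarmonic_eq hk ((norm_rotate one_le_two Θ x).trans hx)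
  simp only [hΘ, coord_rotate_of_three_le le_rfl]
  exact (h.const_mul _).ofReal_comp

theorem beta_mul_symHarmonic_succ {l k : ℕ} (hk : k ≤ l)
    {x : EuclideanSpace ℝ (Fin (2 + 1))} (hx : ‖x‖ = 1) :
    (beta 2 l k : ℂ) * symHarmonic l ((k : ℤ) + 1) x =
      ((normConst 2 l (firstIndex k) * ((2 * k + 1) / 2 *
        axialPolynomialTwo l (k + 1) (coord 2 x 1) (coord 2 x 2) (coord 2 x 3)) : ℝ) : ℂ) := by
  rw [show (k : ℤ) + 1 = (k + 1 : ℕ) by push_cast; ring]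
  rcases hk.lt_or_eq with hk | rfl
  · rw [symHarmonic_eq hk hx, ← Complex.ofReal_mul, ← mul_assoc, ← mul_assoc,
      beta_two_mul_normConst_succ hk]
  · rw [symHarmonic_of_lt (Nat.lt_succ_self k), axialPolynomialTwo,
      homGegenbauer_of_neg _ (by omega)]
    simp

theorem hasDerivAt_symHarmonic_zero (l : ℕ) {x : EuclideanSpace ℝ (Fin (2 + 1))} (hx : ‖x‖ = 1) :
    HasDerivAt (fun Θ : ℝ => symHarmonic l 0 (rotate 2 Θ x))
      (-(√((l : ℝ) * (l + 1)) : ℂ) * symHarmonic l 1 x) 0 := by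
  have c1 := coord_rotate_zero_one one_le_two x
  have c2 := coord_rotate_zero_two one_le_two x
  have h := hasDerivAt_symHarmonic_of_axialPolynomialTwo (Nat.zero_le l) hx
    (hasDerivAt_axialPolynomialTwo_zero l (t := fun Θ => coord 2 (rotate 2 Θ x) 1)
      (u := fun Θ => coord 2 (rotate 2 Θ x) 2) (coord 2 x 3)
      ((hasDerivAt_coord_rotate_one one_le_two x).congr_deriv (by rw [c2])))
  rw [c1, c2] at h
  refine HasDerivAt.congr_deriv h ?_
  have hb := beta_mul_symHarmonic_succ (Nat.zero_le l) hx
  -- The coefficient is twice β_{l,0}: for k = 0 the neighbours k = 1 and k = -1 both belong to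
  -- Ỹ_l^1.
  have hβ : (√((l : ℝ) * (l + 1)) : ℂ) = 2 * (beta 2 l (0 : ℕ) : ℂ) := by
    simp [beta]
    ring
  rw [Nat.cast_zero, zero_add] at hb
  rw [hβ, Nat.cast_zero]
  push_cast at hb ⊢
  linear_combination 2 * hb

theorem hasDerivAt_symHarmonic_succ {l k : ℕ} (hk : k + 1 ≤ l)
    {x : EuclideanSpace ℝ (Fin (2 + 1))} (hx : ‖x‖ = 1) :
    HasDerivAt (fun Θ : ℝ => symHarmonic l (k + 1 : ℕ) (rotate 2 Θ x))
      ((beta 2 l k : ℂ) * symHarmonic l k x -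
        (beta 2 l (k + 1 : ℕ) : ℂ) * symHarmonic l (((k + 1 : ℕ) : ℤ) + 1) x) 0 := by
  have c1 := coord_rotate_zero_one one_le_two x
  have c2 := coord_rotate_zero_two one_le_two x
  have hs : coord 2 x 2 ^ 2 + coord 2 x 3 ^ 2 = 1 - coord 2 x 1 ^ 2 := by
    rw [← tailNorm_two_sq hx, tailNorm_two_two, ← Complex.normSq_eq_norm_sq, Complex.normSq_mk]
    ring
  have h := hasDerivAt_symHarmonic_of_axialPolynomialTwo hk hx
    (hasDerivAt_axialPolynomialTwo_succ l k (t := fun Θ => coord 2 (rotate 2 Θ x) 1)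
      (u := fun Θ => coord 2 (rotate 2 Θ x) 2) (v := coord 2 x 3)
      ((hasDerivAt_coord_rotate_one one_le_two x).congr_deriv (by rw [c2]))
      ((hasDerivAt_coord_rotate_two one_le_two x).congr_deriv c1.symm) (by rw [c1, c2, hs]))
  rw [c1, c2] at h
  refine HasDerivAt.congr_deriv h ?_
  rw [beta_mul_symHarmonic_succ hk hx, symHarmonic_eq (by omega) hx, ← Complex.ofReal_mul,
    ← mul_assoc, beta_two_mul_normConst hk, ← Complex.ofReal_sub]
  congr 1
  ring

end Hyperspherical

end

open Hyperspherical in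
theorem mainTheorem4 :
    (∀ n l k₁ : ℕ, 3 ≤ n → k₁ ≤ l → ∀ x : EuclideanSpace ℝ (Fin (n + 1)), ‖x‖ = 1 →
      HasDerivAt (fun Θ : ℝ => harmonic n l (firstIndex k₁) (rotate n Θ x))
        ((beta n l ((k₁ : ℤ) - 1) : ℂ) * harmonic n l (firstIndex ((k₁ : ℤ) - 1)) x -
          (beta n l k₁ : ℂ) * harmonic n l (firstIndex ((k₁ : ℤ) + 1)) x) 0) ∧
    (∀ l : ℕ, ∀ x : EuclideanSpace ℝ (Fin (2 + 1)), ‖x‖ = 1 →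
      HasDerivAt (fun Θ : ℝ => symHarmonic l 0 (rotate 2 Θ x))
          (-(√((l : ℝ) * (l + 1)) : ℂ) * symHarmonic l 1 x) 0 ∧
        ∀ k : ℕ, 1 ≤ k → k ≤ l →
          HasDerivAt (fun Θ : ℝ => symHarmonic l k (rotate 2 Θ x))
            ((beta 2 l ((k : ℤ) - 1) : ℂ) * symHarmonic l ((k : ℤ) - 1) x -
              (beta 2 l k : ℂ) * symHarmonic l ((k : ℤ) + 1) x) 0) := by
  refine ⟨fun n l k hn hk x hx => hasDerivAt_harmonic_firstIndex hn hk hx, fun l x hx =>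
    ⟨hasDerivAt_symHarmonic_zero l hx, fun k h1 hk => ?_⟩⟩
  obtain ⟨k, rfl⟩ : ∃ m, k = m + 1 := ⟨k - 1, by omega⟩
  rw [show ((k + 1 : ℕ) : ℤ) - 1 = k by push_cast; ring]
  exact hasDerivAt_symHarmonic_succ hk hx
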